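/- Call $\alpha \in \mathbb{R}$ badly approximable if there is $c > 0$ such that $\left|\alpha - \frac{p}{q}\right| \geq \frac{c}{q^2}$ for all $p \in \mathbb{Z}$ and all integers $q \geq 1$. Let $\mathbb{T} = \mathbb{R}/\mathbb{Z}$ with its usual distance $|x-y|$ (the distance from $x-y$ to the nearest integer) and Lebesgue measure $dx$ of total mass $1$, and for probability measures $\mu, \nu$ on $\mathbb{T}$ let $$W_2(\mu,\nu) = \left(\inf_{\gamma} \int_{\mathbb{T}\times\mathbb{T}} |x-y|^2 \, d\gamma(x,y)\right)^{1/2},$$ where the infimum is over all measures $\gamma$ on $\mathbb{T}\times\mathbb{T}$ with marginals $\mu$ and $\nu$. Let $\{x\} = x - \lfloor x \rfloor$ denote the fractional part. Theorem 3 (Earth Mover Distance for Kronecker sequences). Let $\alpha \in \mathbb{R}$ be badly approximable. Then there is a constant $C_\alpha > 0$, depending only on $\alpha$, such that for all integers $N \geq 2$ $$W_2\left(\frac{1}{N}\sum_{n=1}^{N} \delta_{\{n\alpha\}},\, dx\right) \leq C_\alpha \frac{(\log N)^{1/2}}{N}.$$ -/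

import Mathlib

open MeasureTheory

open scoped ENNReal

/-- A real number `α` is badly approximable if there is a constant `c > 0` such that
`|α - p / q| ≥ c / q ^ 2` for every rational number `p / q` (with denominator `q ≥ 1`). -/
def BadlyApproximable (α : ℝ) : Prop :=
  ∃ c : ℝ, 0 < c ∧ ∀ (p : ℤ) (q : ℕ), 1 ≤ q → c / (q : ℝ) ^ 2 ≤ |α - (p : ℝ) / (q : ℝ)|

/-- The set `Γ(μ, ν)` of all couplings of `μ` and `ν`: the measures on the product whose
first marginal is `μ` and whose second marginal is `ν`. -/
def couplings {X : Type*} [MeasurableSpace X] (μ ν : Measure X) : Set (Measure (X × X)) :=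
  {γ | γ.map Prod.fst = μ ∧ γ.map Prod.snd = ν}

/-- The `p`-Wasserstein distance
`W_p(μ, ν) = (inf_{γ ∈ Γ(μ, ν)} ∫ |x - y| ^ p dγ(x, y)) ^ (1 / p)`, with values in `[0, ∞]`. -/
noncomputable def wassersteinDist {X : Type*} [PseudoEMetricSpace X] [MeasurableSpace X]
    (p : ℝ) (μ ν : Measure X) : ℝ≥0∞ :=
  (⨅ γ ∈ couplings μ ν, ∫⁻ z, edist z.1 z.2 ^ p ∂γ) ^ (1 / p)

/-- The empirical measure `(1 / N) ∑_{n = 1}^N δ_{{n α}}` of the Kronecker sequence, on the torus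
`𝕋 = ℝ / ℤ`. -/
noncomputable def kroneckerMeasure (α : ℝ) (N : ℕ) : Measure UnitAddCircle :=
  (N : ℝ≥0∞)⁻¹ •
    ∑ n ∈ Finset.Icc 1 N, Measure.dirac ((Int.fract ((n : ℝ) * α) : ℝ) : UnitAddCircle)

/-! Spread mass `1 / N` from the `n`-th point over the arc whose index is the rank of that point,
all arcs being shifted by a common amount. The rank differs from `N {nα}` by a constant minus
`S(nα)`, where `S` is the sum of the sawtooth translated to the points (`kroneckerRank_eq`). A
suitable shift removes the constant, so the squared cost is at most `2 N⁻³ ∑ S(nα)² + 2 N⁻²`, and it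
remains to prove `∑ S(nα)² = O(N log N)`.

Distinct points are `c / N`-separated and `S` rises by at most `c` on the arc of that length after
each point, so the sum over points is controlled by `N ∫ S²` (`sum_sawtoothSum_sq_le`). By Parseval
and the geometric sum, `∫ S²` is bounded by `∑ min(N², ‖kα‖⁻²) / k²` up to a constant. Bad
approximability makes each dyadic block of `k` below `N` contribute `O(1)`, and the tail `O(1)` in
total: this is the logarithm (`exists_sum_div_sq_le`). -/

/-! ### Diophantine sums -/

/-- The distance from `k α` to the nearest integer is at least `c / |k|`. -/
theorem BadlyApproximable.exists_le_mul_norm {α : ℝ} (hα : BadlyApproximable α) :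
    ∃ c : ℝ, 0 < c ∧ ∀ k : ℤ, k ≠ 0 →
      c ≤ |(k : ℝ)| * ‖((k * α : ℝ) : UnitAddCircle)‖ := by
  obtain ⟨c, hc, h⟩ := hα
  refine ⟨c, hc, fun k hk => ?_⟩
  have key : ∀ q : ℕ, 1 ≤ q → c ≤ (q : ℝ) * ‖((q * α : ℝ) : UnitAddCircle)‖ := by
    intro q hq
    have hq0 : (0 : ℝ) < q := by exact_mod_cast hq
    have h1 := h (round ((q : ℝ) * α)) q hq
    rw [UnitAddCircle.norm_eq]
    have h2 : (q : ℝ) * α - round ((q : ℝ) * α) = q * (α - (round ((q : ℝ) * α) : ℝ) / q) := by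
      field_simp
    rw [h2, abs_mul, abs_of_pos hq0, ← mul_assoc]
    rw [div_le_iff₀ (by positivity)] at h1
    linarith
  have h3 := key k.natAbs (by omega)
  have h4 : ((k.natAbs : ℕ) : ℝ) = |(k : ℝ)| := by rw [Nat.cast_natAbs, Int.cast_abs]
  rw [h4] at h3
  rcases abs_choice (k : ℝ) with h5 | h5
  · rw [h5] at h3 ⊢; exact h3
  · rw [h5] at h3 ⊢
    rwa [neg_mul (k : ℝ) α, AddCircle.coe_neg, norm_neg] at h3

theorem summable_one_div_one_add_int_sq : Summable fun b : ℤ => 1 / (1 + (b : ℝ) ^ 2) := by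
  have h : Summable fun b : ℤ => 1 / (b : ℝ) ^ 2 := Real.summable_one_div_int_pow.mpr one_lt_two
  refine h.of_norm_bounded_eventually ?_
  refine (Set.finite_singleton (0 : ℤ)).subset ?_
  intro b hb
  by_contra hb0
  apply hb
  have : (0 : ℝ) < (b : ℝ) ^ 2 := by
    have : (b : ℝ) ≠ 0 := by exact_mod_cast hb0
    positivity
  rw [Set.mem_ofPred_eq, Real.norm_of_nonneg (by positivity)]
  exact one_div_le_one_div_of_le this (by linarith)

section
variable {α c : ℝ}

/-- The multiples `k α` for `k` in a window of `M` integers are `c / M`-separated, so the sum of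
`1 / (1 + (M ‖k α‖)²)` over the window is bounded independently of `M`. -/
theorem exists_sum_window_le (hc : 0 < c)
    (h : ∀ k : ℤ, k ≠ 0 → c ≤ |(k : ℝ)| * ‖((k * α : ℝ) : UnitAddCircle)‖) :
    ∃ A : ℝ, 0 < A ∧ ∀ a M : ℕ, 1 ≤ M →
      ∑ k ∈ Finset.Ico a (a + M), 1 / (1 + ((M : ℝ) * ‖((k * α : ℝ) : UnitAddCircle)‖) ^ 2) ≤
        A := by
  have hS := summable_one_div_one_add_int_sq
  have hnn : ∀ b : ℤ, 0 ≤ 1 / (1 + (b : ℝ) ^ 2) := fun b => by positivity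
  have hpos : 0 < ∑' b : ℤ, 1 / (1 + (b : ℝ) ^ 2) := hS.tsum_pos hnn 0 (by norm_num)
  refine ⟨(3 + 2 / c ^ 2) * ∑' b : ℤ, 1 / (1 + (b : ℝ) ^ 2), by positivity, fun a M hM => ?_⟩
  have hM0 : (0 : ℝ) < M := by exact_mod_cast hM
  set e : ℕ → ℝ := fun k => (k : ℝ) * α - round ((k : ℝ) * α) with he
  -- Cells of length `c / M` each contain at most one signed remainder `e k`. Replacing `M e k` by
  -- its cell index costs the factor `3 + 2 / c ^ 2`.
  set b : ℕ → ℤ := fun k => ⌊(M : ℝ) * e k / c⌋ with hb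
  have hinj : Set.InjOn b (Finset.Ico a (a + M)) := by
    intro k hk l hl hkl
    by_contra hne
    simp only [Finset.coe_Ico, Set.mem_Ico] at hk hl
    have h1 := Int.abs_sub_lt_one_of_floor_eq_floor hkl
    have h2 : |e k - e l| * M < c := by
      rw [← sub_div, ← mul_sub, abs_div, abs_mul, abs_of_pos hc, abs_of_pos hM0,
        div_lt_one hc] at h1
      linarith
    have h3 := h ((k : ℤ) - l) (by omega)
    have h4 : ‖((((k : ℤ) - l : ℤ) * α : ℝ) : UnitAddCircle)‖ ≤ |e k - e l| := by
      rw [UnitAddCircle.norm_eq]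
      refine (round_le _ (round ((k : ℝ) * α) - round ((l : ℝ) * α))).trans (le_of_eq ?_)
      congr 1
      simp only [he]; push_cast; ring
    have h5 : |(((k : ℤ) - l : ℤ) : ℝ)| ≤ M := by
      rw [abs_le]; constructor
      · have : -(M : ℤ) ≤ (k : ℤ) - l := by omega
        exact_mod_cast this
      · have : (k : ℤ) - l ≤ M := by omega
        exact_mod_cast this
    have h6 := mul_le_mul h5 h4 (norm_nonneg _) hM0.le
    linarith
  calc ∑ k ∈ Finset.Ico a (a + M), 1 / (1 + ((M : ℝ) * ‖((k * α : ℝ) : UnitAddCircle)‖) ^ 2)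
      ≤ ∑ k ∈ Finset.Ico a (a + M), (3 + 2 / c ^ 2) * (1 / (1 + (b k : ℝ) ^ 2)) := by
        refine Finset.sum_le_sum fun k _ => ?_
        have h1 : ‖((k * α : ℝ) : UnitAddCircle)‖ = |e k| := UnitAddCircle.norm_eq
        rw [h1, mul_pow, sq_abs, ← mul_pow, mul_one_div, div_le_div_iff₀ (by positivity)
          (by positivity), one_mul]
        set y := (M : ℝ) * e k with hy
        have h2 : (b k : ℝ) ≤ y / c := Int.floor_le _
        have h3 : y / c < b k + 1 := Int.lt_floor_add_one _
        have h4 : (b k : ℝ) ^ 2 ≤ 2 * (y / c) ^ 2 + 2 := by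
          nlinarith [sq_nonneg ((b k : ℝ) - 2 * (y / c))]
        rw [div_pow] at h4
        have h5 : (3 + 2 / c ^ 2) * (1 + y ^ 2) =
          3 + 3 * y ^ 2 + 2 / c ^ 2 + 2 * (y ^ 2 / c ^ 2) := by ring
        rw [h5]
        have : 0 ≤ 2 / c ^ 2 := by positivity
        nlinarith [sq_nonneg y]
    _ = (3 + 2 / c ^ 2) * ∑ m ∈ (Finset.Ico a (a + M)).image b, 1 / (1 + (m : ℝ) ^ 2) := by
        rw [Finset.sum_image hinj, Finset.mul_sum]
    _ ≤ _ := by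
        gcongr
        exact hS.sum_le_tsum _ fun m _ => hnn m

/-- The logarithmic growth of `∑ min(N², ‖k α‖⁻²) / k²`, with smoothed weights. -/
theorem exists_sum_div_sq_le (hc : 0 < c)
    (h : ∀ k : ℤ, k ≠ 0 → c ≤ |(k : ℝ)| * ‖((k * α : ℝ) : UnitAddCircle)‖) :
    ∃ A : ℝ, 0 < A ∧ ∀ J L N : ℕ, 1 ≤ N → N ≤ 2 ^ J →
      ∑ k ∈ Finset.Ico 1 L, ((N : ℝ) ^ 2 /
        (1 + ((N : ℝ) * ‖((k * α : ℝ) : UnitAddCircle)‖) ^ 2)) / (k : ℝ) ^ 2 ≤ A * (J + 2) := by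
  obtain ⟨A, hA, hw⟩ := exists_sum_window_le hc h
  set d : ℕ → ℝ := fun k => ‖((k * α : ℝ) : UnitAddCircle)‖ with hd
  have hd0 : ∀ k, 0 ≤ d k := fun k => norm_nonneg _
  refine ⟨(2 + 4 / c ^ 2) * A, by positivity, fun J L N hN hNJ => ?_⟩
  have hN0 : (0 : ℝ) < N := by exact_mod_cast hN
  set t : ℕ → ℝ := fun k => ((N : ℝ) ^ 2 / (1 + ((N : ℝ) * d k) ^ 2)) / (k : ℝ) ^ 2 with ht
  have ht0 : ∀ k, 0 ≤ t k := fun k => by positivity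
  -- Below `2 ^ J` the cutoff `N` is dropped. Since `k ‖kα‖ ≥ c`, the quantity `M ‖kα‖` is at least
  -- `c / 2`, so `1 / y` and `1 / (1 + y)` are comparable for `y = (M ‖kα‖)²`.
  have hlow : ∀ j : ℕ, ∑ k ∈ Finset.Ico (2 ^ j) (2 ^ (j + 1)), t k ≤ (2 + 4 / c ^ 2) * A := by
    intro j
    have := hw (2 ^ j) (2 ^ j) Nat.one_le_two_pow
    rw [← two_mul, ← pow_succ'] at this
    refine le_trans ?_ (mul_le_mul_of_nonneg_left this (by positivity))
    rw [Finset.mul_sum]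
    refine Finset.sum_le_sum fun k hk => ?_
    rw [Finset.mem_Ico] at hk
    set M : ℝ := ((2 ^ j : ℕ) : ℝ) with hM
    have hM1 : 0 < M := by positivity
    have hkM : M ≤ k := by rw [hM]; exact_mod_cast hk.1
    have hkM' : (k : ℝ) ≤ 2 * M := by
      have : k ≤ 2 * 2 ^ j := by rw [← pow_succ']; exact hk.2.le
      rw [hM]; exact_mod_cast this
    have hk0 : (0 : ℝ) < k := hM1.trans_le hkM
    have h1 : c ≤ (k : ℝ) * d k := by
      have := h k (by have : k ≠ 0 := by rintro rfl; simp at hk0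
                      exact_mod_cast this)
      simpa [abs_of_pos hk0, hd] using this
    have hdk : 0 < d k := by
      by_contra hcon
      have : d k = 0 := le_antisymm (not_lt.mp hcon) (hd0 k)
      rw [this] at h1; linarith
    have h2 : c ≤ 2 * (M * d k) := by nlinarith
    have h3 : c ^ 2 ≤ 4 * (M * d k) ^ 2 := by nlinarith
    have h4 : t k ≤ 1 / (M * d k) ^ 2 := by
      calc t k ≤ (1 / d k ^ 2) / (k : ℝ) ^ 2 := by
            simp only [ht]
            gcongr ?_ / _
            rw [div_le_div_iff₀ (by positivity) (by positivity)]
            nlinarith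
        _ = 1 / ((k : ℝ) * d k) ^ 2 := by rw [div_div, mul_pow, mul_comm]
        _ ≤ _ := by gcongr
    refine h4.trans ?_
    set y := (M * d k) ^ 2 with hy
    have hy0 : 0 < y := by positivity
    change 1 / y ≤ (2 + 4 / c ^ 2) * (1 / (1 + y))
    rw [mul_one_div, div_le_div_iff₀ hy0 (by positivity)]
    have : 1 ≤ 4 / c ^ 2 * y := by
      rw [div_mul_eq_mul_div, one_le_div (by positivity)]; exact h3
    nlinarith
  have hlow' : ∀ j : ℕ, ∑ k ∈ Finset.Ico 1 (2 ^ j), t k ≤ j * ((2 + 4 / c ^ 2) * A) := by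
    intro j
    induction j with
    | zero => simp
    | succ j ih =>
      rw [← Finset.sum_Ico_consecutive t (Nat.one_le_two_pow (n := j))
        (Nat.pow_le_pow_right (by norm_num) (Nat.le_succ j))]
      push_cast
      linarith [hlow j]
  -- Beyond `2 ^ J`, blocks of fixed length suffice: the weight increases with `N`, so `N` may be
  -- replaced by `2 ^ J`, and `k ≥ 2 ^ J * i` supplies the summable factor `1 / i²`.
  have hhigh : ∀ i : ℕ, 1 ≤ i →
      ∑ k ∈ Finset.Ico (2 ^ J * i) (2 ^ J * i + 2 ^ J), t k ≤ A / (i : ℝ) ^ 2 := by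
    intro i hi
    have hi0 : (0 : ℝ) < i := by exact_mod_cast hi
    have := hw (2 ^ J * i) (2 ^ J) Nat.one_le_two_pow
    rw [div_eq_inv_mul]
    refine le_trans ?_ (mul_le_mul_of_nonneg_left this (by positivity))
    rw [Finset.mul_sum]
    refine Finset.sum_le_sum fun k hk => ?_
    rw [Finset.mem_Ico] at hk
    set M : ℝ := ((2 ^ J : ℕ) : ℝ) with hM
    have hM1 : 0 < M := by positivity
    have hNM : (N : ℝ) ≤ M := by rw [hM]; exact_mod_cast hNJ
    have hkM : M * i ≤ k := by rw [hM]; exact_mod_cast hk.1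
    have h1 : (N : ℝ) ^ 2 / (1 + ((N : ℝ) * d k) ^ 2) ≤ M ^ 2 / (1 + (M * d k) ^ 2) := by
      rw [div_le_div_iff₀ (by positivity) (by positivity)]
      have : (N : ℝ) ^ 2 ≤ M ^ 2 := by gcongr
      nlinarith
    calc t k ≤ (M ^ 2 / (1 + (M * d k) ^ 2)) / (M * i) ^ 2 := by simp only [ht]; gcongr
      _ = _ := by field_simp; rfl
  have hhigh' : ∀ i : ℕ, 1 ≤ i →
      ∑ k ∈ Finset.Ico (2 ^ J) (2 ^ J * (i + 1)), t k ≤ A * (2 - 1 / (i : ℝ)) := by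
    intro i hi
    induction i, hi using Nat.le_induction with
    | base =>
      have h1 := hhigh 1 le_rfl
      rw [show 2 ^ J * (1 + 1) = 2 ^ J * 1 + 2 ^ J by ring]
      norm_num at h1 ⊢
      linarith
    | succ i hi ih =>
      rw [← Finset.sum_Ico_consecutive t (n := 2 ^ J * (i + 1))
        (Nat.le_mul_of_pos_right _ (by omega)) (by gcongr; omega)]
      have h1 := hhigh (i + 1) (by omega)
      rw [show 2 ^ J * (i + 1 + 1) = 2 ^ J * (i + 1) + 2 ^ J by ring]
      have hi1 : (0 : ℝ) < i := by exact_mod_cast hi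
      have h2 : A / ((i : ℝ) + 1) ^ 2 ≤ A * (1 / (i : ℝ) - 1 / ((i : ℝ) + 1)) := by
        rw [div_eq_mul_one_div]
        gcongr
        rw [div_sub_div _ _ (by positivity) (by positivity), div_le_div_iff₀ (by positivity)
          (by positivity)]
        nlinarith
      push_cast at h1 ⊢
      linarith
  have hL : L ≤ 2 ^ J * (L + 1 + 1) := by nlinarith [Nat.one_le_two_pow (n := J)]
  calc ∑ k ∈ Finset.Ico 1 L, t k ≤ ∑ k ∈ Finset.Ico 1 (2 ^ J * (L + 1 + 1)), t k :=
        Finset.sum_le_sum_of_subset_of_nonneg (Finset.Ico_subset_Ico_right hL)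
          fun k _ _ => ht0 k
    _ = ∑ k ∈ Finset.Ico 1 (2 ^ J), t k + ∑ k ∈ Finset.Ico (2 ^ J) (2 ^ J * (L + 1 + 1)), t k :=
        (Finset.sum_Ico_consecutive t Nat.one_le_two_pow
          (Nat.le_mul_of_pos_right _ (by omega))).symm
    _ ≤ J * ((2 + 4 / c ^ 2) * A) + A * (2 - 1 / ((L + 1 : ℕ) : ℝ)) :=
        add_le_add (hlow' J) (hhigh' _ (by omega))
    _ ≤ _ := by
        have h1 : 0 ≤ A * (1 / ((L + 1 : ℕ) : ℝ)) := by positivity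
        have h2 : 0 ≤ 4 / c ^ 2 * A := by positivity
        nlinarith
end

/-! ### Transport cost of a matching with arcs -/

theorem sum_restrict_Ioc_consecutive {a : ℕ → ℝ} (ha : Monotone a) (N : ℕ) :
    ∑ j ∈ Finset.range N, (volume : Measure ℝ).restrict (Set.Ioc (a j) (a (j + 1))) =
      volume.restrict (Set.Ioc (a 0) (a N)) := by
  induction N with
  | zero => simp
  | succ N ih =>
    rw [Finset.sum_range_succ, ih, ← Measure.restrict_union _ measurableSet_Ioc,
      Set.Ioc_union_Ioc_eq_Ioc (ha (Nat.zero_le _)) (ha (Nat.le_succ _))]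
    rw [Set.disjoint_left]
    intro x hx hx'
    exact absurd hx.2 (not_le.mpr hx'.1)

/-- Upper bound for the quadratic Wasserstein distance from `N` equal point masses to the uniform
measure on the circle: send an arc of length `1 / N` to each of the points. -/
theorem wassersteinDist_two_sq_le {N : ℕ} (hN : 1 ≤ N) (x : ℕ → ℝ) (c : ℝ) {r : ℕ → ℕ}
    (hr : Set.BijOn r (Finset.Icc 1 N) (Finset.Icc 1 N)) :
    wassersteinDist 2 ((N : ℝ≥0∞)⁻¹ • ∑ n ∈ Finset.Icc 1 N, Measure.dirac (x n : UnitAddCircle))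
      (volume : Measure UnitAddCircle) ≤
    ENNReal.ofReal (Real.sqrt
      (2 / N * ∑ n ∈ Finset.Icc 1 N, (x n - (r n / N + c)) ^ 2 + 2 / (N : ℝ) ^ 2)) := by
  have hN0 : (0 : ℝ) < N := by exact_mod_cast hN
  set a : ℕ → ℝ := fun j => (j : ℝ) / N + c with ha
  have hmono : Monotone a := fun i j hij => by
    have : (i : ℝ) ≤ j := by exact_mod_cast hij
    simp only [ha]; gcongr
  set ν : ℕ → Measure ℝ := fun n => volume.restrict (Set.Ioc (a (r n - 1)) (a (r n))) with hν
  have hr1 : ∀ n ∈ Finset.Icc 1 N, 1 ≤ r n := fun n hn => by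
    have := hr.mapsTo hn
    simp at this; exact this.1
  have hlen : ∀ n ∈ Finset.Icc 1 N, a (r n) - a (r n - 1) = 1 / N := fun n hn => by
    simp only [ha]; rw [Nat.cast_sub (hr1 n hn)]; push_cast; ring
  have hνuniv : ∀ n ∈ Finset.Icc 1 N, ν n Set.univ = (N : ℝ≥0∞)⁻¹ := fun n hn => by
    simp only [hν, Measure.restrict_apply_univ, Real.volume_Ioc]
    rw [hlen n hn, one_div, ENNReal.ofReal_inv_of_pos hN0, ENNReal.ofReal_natCast]
  have hνsum : ∑ n ∈ Finset.Icc 1 N, ν n = volume.restrict (Set.Ioc c (c + 1)) := by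
    have h1 : ∑ n ∈ Finset.Icc 1 N, ν n = ∑ j ∈ Finset.Icc 1 N,
        (volume : Measure ℝ).restrict (Set.Ioc (a (j - 1)) (a j)) :=
      Finset.sum_nbij r hr.mapsTo hr.injOn hr.surjOn fun n _ => rfl
    rw [h1, ← Finset.Ico_add_one_right_eq_Icc, Finset.sum_Ico_eq_sum_range]
    simp only [Nat.add_sub_cancel, Nat.add_sub_cancel_left]
    have h2 := sum_restrict_Ioc_consecutive hmono N
    simp only [add_comm 1]
    rw [h2]
    simp [ha, hN0.ne', add_comm]
  set F : ℕ → ℝ → UnitAddCircle × UnitAddCircle := fun n u =>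
    ((x n : UnitAddCircle), (u : UnitAddCircle)) with hF
  have hcoe : Measurable ((↑) : ℝ → UnitAddCircle) := AddCircle.measurable_mk'
  have hFm : ∀ n, Measurable (F n) := fun n => measurable_const.prodMk hcoe
  set γ : Measure (UnitAddCircle × UnitAddCircle) := ∑ n ∈ Finset.Icc 1 N, (ν n).map (F n) with hγ
  have hmem : γ ∈ couplings ((N : ℝ≥0∞)⁻¹ • ∑ n ∈ Finset.Icc 1 N,
      Measure.dirac (x n : UnitAddCircle)) (volume : Measure UnitAddCircle) := by
    constructor
    · rw [hγ, ← Measure.mapₗ_apply_of_measurable measurable_fst, map_sum, Finset.smul_sum]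
      refine Finset.sum_congr rfl fun n hn => ?_
      rw [Measure.mapₗ_apply_of_measurable measurable_fst, Measure.map_map measurable_fst (hFm n)]
      have : Prod.fst ∘ F n = fun _ => (x n : UnitAddCircle) := rfl
      rw [this, Measure.map_const, hνuniv n hn]
    · rw [hγ, ← Measure.mapₗ_apply_of_measurable measurable_snd, map_sum]
      have : ∀ n ∈ Finset.Icc 1 N, (Measure.mapₗ Prod.snd) ((ν n).map (F n)) =
          Measure.mapₗ ((↑) : ℝ → UnitAddCircle) (ν n) := fun n _ => by
        rw [Measure.mapₗ_apply_of_measurable measurable_snd,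
          Measure.mapₗ_apply_of_measurable hcoe, Measure.map_map measurable_snd (hFm n)]
        rfl
      rw [Finset.sum_congr rfl this, ← map_sum, hνsum, Measure.mapₗ_apply_of_measurable hcoe]
      exact (UnitAddCircle.measurePreserving_mk c).map_eq
  have hcost : ∀ n ∈ Finset.Icc 1 N, ∫⁻ z, edist z.1 z.2 ^ (2 : ℝ) ∂((ν n).map (F n)) ≤
      ENNReal.ofReal (2 / N * (x n - (r n / N + c)) ^ 2 + 2 / (N : ℝ) ^ 3) := by
    intro n hn
    rw [lintegral_map (by fun_prop) (hFm n)]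
    -- Moving the target from `u` to the right end of its arc changes it by at most `1 / N`; then
    -- `(v + w)² ≤ 2 v² + 2 w²`.
    have hpt : ∀ u ∈ Set.Ioc (a (r n - 1)) (a (r n)),
        edist (F n u).1 (F n u).2 ^ (2 : ℝ) ≤
          ENNReal.ofReal (2 * (x n - a (r n)) ^ 2 + 2 / (N : ℝ) ^ 2) := by
      intro u hu
      have h1 : edist (F n u).1 (F n u).2 ≤ ENNReal.ofReal |x n - u| := by
        rw [edist_dist]
        refine ENNReal.ofReal_le_ofReal ?_
        rw [dist_eq_norm]
        simp only [hF]
        rw [← AddCircle.coe_sub, UnitAddCircle.norm_eq]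
        simpa using round_le (x n - u) 0
      refine (ENNReal.rpow_le_rpow h1 (by norm_num)).trans ?_
      rw [ENNReal.ofReal_rpow_of_nonneg (abs_nonneg _) (by norm_num)]
      refine ENNReal.ofReal_le_ofReal ?_
      rw [Real.rpow_two, sq_abs]
      have h2 : 0 ≤ a (r n) - u := sub_nonneg.mpr hu.2
      have h3 : a (r n) - u ≤ 1 / N := by rw [← hlen n hn]; linarith [hu.1]
      have h4 : (a (r n) - u) ^ 2 ≤ 1 / (N : ℝ) ^ 2 := by
        calc _ ≤ (1 / (N : ℝ)) ^ 2 := by gcongr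
          _ = _ := by rw [div_pow, one_pow]
      have h5 : 2 / (N : ℝ) ^ 2 = 2 * (1 / (N : ℝ) ^ 2) := by ring
      rw [h5]
      nlinarith [sq_nonneg ((x n - a (r n)) - (a (r n) - u))]
    calc _ ≤ ∫⁻ _ in Set.Ioc (a (r n - 1)) (a (r n)),
            ENNReal.ofReal (2 * (x n - a (r n)) ^ 2 + 2 / (N : ℝ) ^ 2) :=
          setLIntegral_mono' measurableSet_Ioc hpt
      _ = _ := by
          rw [setLIntegral_const, Real.volume_Ioc, hlen n hn,
            ← ENNReal.ofReal_mul (by positivity)]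
          congr 1
          simp only [ha]
          field_simp
  rw [wassersteinDist]
  calc _ ≤ (∫⁻ z, edist z.1 z.2 ^ (2 : ℝ) ∂γ) ^ (1 / 2 : ℝ) :=
        ENNReal.rpow_le_rpow (iInf₂_le γ hmem) (by norm_num)
    _ ≤ (ENNReal.ofReal (2 / N * ∑ n ∈ Finset.Icc 1 N, (x n - (r n / N + c)) ^ 2 +
          2 / (N : ℝ) ^ 2)) ^ (1 / 2 : ℝ) := by
        refine ENNReal.rpow_le_rpow ?_ (by norm_num)
        rw [hγ, lintegral_finsetSum_measure]
        refine (Finset.sum_le_sum hcost).trans (le_of_eq ?_)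
        rw [← ENNReal.ofReal_sum_of_nonneg fun n _ => by positivity, Finset.sum_add_distrib,
          ← Finset.mul_sum]
        congr 2
        simp
        field_simp
    _ = _ := by
        rw [ENNReal.ofReal_rpow_of_nonneg (by positivity) (by norm_num), Real.sqrt_eq_rpow]

/-! ### Mean square of the sawtooth sum -/

theorem measurable_periodizedBernoulli (k : ℕ) : Measurable (periodizedBernoulli k) := by
  have h : periodizedBernoulli k = (fun y : Set.Ico (0 : ℝ) (0 + 1) => bernoulliFun k y) ∘
      AddCircle.measurableEquivIco 1 0 := rfl
  rw [h]
  exact ((continuous_bernoulliFun k).measurable.comp measurable_subtype_coe).comp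
    (AddCircle.measurableEquivIco 1 0).measurable

theorem periodizedBernoulli_one_coe (t : ℝ) :
    periodizedBernoulli 1 (t : UnitAddCircle) = Int.fract t - 1 / 2 := by
  have h : (t : UnitAddCircle) = (Int.fract t : ℝ) := by
    rw [← sub_eq_zero, ← AddCircle.coe_sub, Int.self_sub_fract]
    exact AddCircle.coe_eq_zero_iff _ |>.mpr ⟨⌊t⌋, by simp⟩
  rw [h, periodizedBernoulli, AddCircle.liftIco_zero_coe_apply ⟨Int.fract_nonneg t, Int.fract_lt_one t⟩,
    bernoulliFun_one]

theorem abs_periodizedBernoulli_one_le (x : UnitAddCircle) : |periodizedBernoulli 1 x| ≤ 1 / 2 := by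
  obtain ⟨t, rfl⟩ := QuotientAddGroup.mk_surjective x
  have := periodizedBernoulli_one_coe t
  change |periodizedBernoulli 1 (t : UnitAddCircle)| ≤ _
  rw [this, abs_le]
  constructor <;> linarith [Int.fract_nonneg t, Int.fract_lt_one t]

theorem fourierCoeff_comp_sub_right {E : Type*} [NormedAddCommGroup E] [NormedSpace ℂ E]
    {T : ℝ} [Fact (0 < T)] (f : AddCircle T → E) (a : AddCircle T) (n : ℤ) :
    fourierCoeff (fun x => f (x - a)) n = fourier (-n) a • fourierCoeff f n := by
  have h : ∀ t : AddCircle T, fourier (-n) t • f (t - a) =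
      (fun y => fourier (-n) a • (fourier (-n) y • f y)) (t - a) := fun t => by
    simp only [fourier_apply, smul_smul]
    rw [← Circle.coe_mul, ← AddCircle.toCircle_add, ← zsmul_add, add_sub_cancel]
  simp only [fourierCoeff]
  rw [integral_congr_ae (ae_of_all _ h),
    integral_sub_right_eq_self (fun y => fourier (-n) a • (fourier (-n) y • f y)) a, integral_smul]

/-- The sum of the translates of the sawtooth `{x} - 1 / 2` by `α, 2 α, …, N α`. -/
noncomputable def sawtoothSum (α : ℝ) (N : ℕ) (x : UnitAddCircle) : ℝ :=
  ∑ m ∈ Finset.Icc 1 N, periodizedBernoulli 1 (x - ((m * α : ℝ) : UnitAddCircle))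

theorem measurable_sawtoothSum (α : ℝ) (N : ℕ) : Measurable (sawtoothSum α N) :=
  Finset.measurable_sum _ fun _ _ =>
    (measurable_periodizedBernoulli 1).comp (measurable_id.sub_const _)

theorem abs_sawtoothSum_le (α : ℝ) (N : ℕ) (x : UnitAddCircle) : |sawtoothSum α N x| ≤ N := by
  refine (Finset.abs_sum_le_sum_abs _ _).trans
    ((Finset.sum_le_sum fun m _ => (abs_periodizedBernoulli_one_le _).trans
      (by norm_num : (1 / 2 : ℝ) ≤ 1)).trans (by simp))

theorem integrable_sawtoothSum_sq (α : ℝ) (N : ℕ) :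
    Integrable (fun x => sawtoothSum α N x ^ 2) (volume : Measure UnitAddCircle) := by
  refine Integrable.of_bound ((measurable_sawtoothSum α N).pow_const 2).aestronglyMeasurable
    ((N : ℝ) ^ 2) (ae_of_all _ fun x => ?_)
  rw [Real.norm_eq_abs, abs_pow]
  gcongr
  exact abs_sawtoothSum_le α N x

/-- Translation multiplies a coefficient by a character. At `k = 0` the division by zero returns
`0`, the correct value because the sawtooth has mean zero. -/
theorem fourierCoeff_sawtoothSum (α : ℝ) (N : ℕ) (k : ℤ) :
    fourierCoeff (fun x => (sawtoothSum α N x : ℂ)) k =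
      (∑ m ∈ Finset.Icc 1 N, fourier (-k) ((m * α : ℝ) : UnitAddCircle)) *
        (-1 / (2 * Real.pi * Complex.I * k)) := by
  have h : (fun x => (sawtoothSum α N x : ℂ)) = ∑ m ∈ Finset.Icc 1 N, fun x =>
      ((↑) ∘ periodizedBernoulli 1 : UnitAddCircle → ℂ) (x - ((m * α : ℝ) : UnitAddCircle)) := by
    ext x
    simp [sawtoothSum]
  rw [h, fourierCoeff.sum, Finset.sum_apply, Finset.sum_mul]
  · refine Finset.sum_congr rfl fun m _ => ?_
    rw [fourierCoeff_comp_sub_right, fourierCoeff_bernoulli_eq one_ne_zero]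
    simp
  · intro m _
    refine Integrable.of_bound (C := 1 / 2) (Complex.measurable_ofReal.comp
      ((measurable_periodizedBernoulli 1).comp (measurable_id.sub_const _))).aestronglyMeasurable
      (ae_of_all _ fun x => ?_)
    simp only [Function.comp, Complex.norm_real]
    exact abs_periodizedBernoulli_one_le _

theorem hasSum_sawtoothSum (α : ℝ) (N : ℕ) :
    HasSum (fun k : ℤ => ‖fourierCoeff (fun x => (sawtoothSum α N x : ℂ)) k‖ ^ 2)
      (∫ x : UnitAddCircle, sawtoothSum α N x ^ 2) := by
  have hL : MemLp (fun x => (sawtoothSum α N x : ℂ)) 2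
      (AddCircle.haarAddCircle : Measure UnitAddCircle) := by
    refine MemLp.of_bound (Complex.measurable_ofReal.comp
      (measurable_sawtoothSum α N)).aestronglyMeasurable N (ae_of_all _ fun x => ?_)
    rw [Complex.norm_real]
    exact abs_sawtoothSum_le α N x
  have h := hasSum_sq_fourierCoeff hL.toLp
  rw [fourierCoeff_congr_ae hL.coeFn_toLp] at h
  convert h using 1
  rw [AddCircle.integral_haarAddCircle, inv_one, one_smul]
  refine integral_congr_ae ?_
  have h2 := hL.coeFn_toLp
  have h3 : (volume : Measure UnitAddCircle) = AddCircle.haarAddCircle := by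
    rw [AddCircle.volume_eq_smul_haarAddCircle]; simp
  rw [h3]
  filter_upwards [h2] with x hx
  rw [hx, Complex.norm_real, Real.norm_eq_abs, sq_abs]

/-- The square of a geometric exponential sum with frequency `k α`. -/
theorem norm_sum_fourier_sq_le (α : ℝ) (N : ℕ) (k : ℤ) :
    ‖∑ m ∈ Finset.Icc 1 N, fourier k ((m * α : ℝ) : UnitAddCircle)‖ ^ 2 ≤
      2 * ((N : ℝ) ^ 2 / (1 + ((N : ℝ) * ‖((k * α : ℝ) : UnitAddCircle)‖) ^ 2)) := by
  set y : ℝ := k * α - round ((k : ℝ) * α) with hy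
  rw [UnitAddCircle.norm_eq, ← hy]
  set z : ℂ := Complex.exp (Complex.I * ((2 * Real.pi * y : ℝ) : ℂ)) with hz
  have hz1 : ‖z‖ = 1 := by rw [hz, mul_comm, Complex.norm_exp_ofReal_mul_I]
  have hterm : ∀ m : ℕ, fourier k ((m * α : ℝ) : UnitAddCircle) = z ^ m := by
    intro m
    rw [fourier_coe_apply, hz, ← Complex.exp_nat_mul, Complex.exp_eq_exp_iff_exists_int]
    refine ⟨m * round ((k : ℝ) * α), ?_⟩
    simp only [hy]; push_cast; ring
  simp only [hterm]
  set S := ∑ m ∈ Finset.Icc 1 N, z ^ m with hS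
  have h1 : ‖S‖ ≤ N := by
    refine (norm_sum_le _ _).trans ?_
    simp [hz1]
  have h2 : ‖S‖ * ‖z - 1‖ ≤ 2 := by
    rw [← norm_mul, hS, ← Finset.Ico_add_one_right_eq_Icc, geom_sum_Ico_mul _ (by omega)]
    refine (norm_sub_le _ _).trans ?_
    simp [hz1]; norm_num
  -- Jordan's inequality for `‖z - 1‖ = 2 |sin (π y)|`, valid since `|y| ≤ 1 / 2`.
  have h3 : 4 * |y| ≤ ‖z - 1‖ := by
    rw [hz, Complex.norm_exp_I_mul_ofReal_sub_one, Real.norm_eq_abs, abs_mul, abs_two,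
      show 2 * Real.pi * y / 2 = Real.pi * y by ring]
    have hy2 : |y| ≤ 1 / 2 := abs_sub_round _
    have := Real.mul_abs_le_abs_sin (x := Real.pi * y) (by
      rw [abs_mul, abs_of_pos Real.pi_pos]; nlinarith [Real.pi_pos])
    rw [abs_mul, abs_of_pos Real.pi_pos, ← mul_assoc, div_mul_cancel₀ _ Real.pi_ne_zero] at this
    linarith
  have h4 : ‖S‖ * |y| ≤ 1 / 2 := by nlinarith [norm_nonneg S]
  have h5 : ‖S‖ ^ 2 ≤ (N : ℝ) ^ 2 := by gcongr
  have h6 : (‖S‖ * |y|) ^ 2 ≤ (1 / 2) ^ 2 := by gcongr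
  rw [← mul_div_assoc, le_div_iff₀ (by positivity)]
  have h7 : ‖S‖ ^ 2 * (1 + ((N : ℝ) * |y|) ^ 2) =
    ‖S‖ ^ 2 + (N : ℝ) ^ 2 * (‖S‖ * |y|) ^ 2 := by ring
  rw [h7]
  nlinarith [sq_nonneg (N : ℝ)]

/-- Parseval: the frequencies `k` and `-k` carry the same bound, each at most half of the
corresponding term of the sum, so finite partial sums suffice. -/
theorem integral_sawtoothSum_sq_le {α : ℝ} {N : ℕ} {A : ℝ}
    (h : ∀ L : ℕ, ∑ k ∈ Finset.Ico 1 L, ((N : ℝ) ^ 2 /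
        (1 + ((N : ℝ) * ‖((k * α : ℝ) : UnitAddCircle)‖) ^ 2)) / (k : ℝ) ^ 2 ≤ A) :
    ∫ x : UnitAddCircle, sawtoothSum α N x ^ 2 ≤ A := by
  set f : ℤ → ℝ := fun k => ‖fourierCoeff (fun x => (sawtoothSum α N x : ℂ)) k‖ ^ 2 with hf
  set t : ℕ → ℝ := fun k => ((N : ℝ) ^ 2 /
        (1 + ((N : ℝ) * ‖((k * α : ℝ) : UnitAddCircle)‖) ^ 2)) / (k : ℝ) ^ 2 with ht
  have hfk : ∀ k : ℤ, k ≠ 0 → f k ≤ 1 / 2 * t k.natAbs := by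
    intro k hk
    have hk0 : (0 : ℝ) < (k : ℝ) ^ 2 := by
      have : (k : ℝ) ≠ 0 := by exact_mod_cast hk
      positivity
    have h1 := norm_sum_fourier_sq_le α N (-k)
    have h2 : ‖(((-k : ℤ) * α : ℝ) : UnitAddCircle)‖ =
        ‖((k.natAbs * α : ℝ) : UnitAddCircle)‖ := by
      have h4 : ((k.natAbs : ℕ) : ℝ) = |(k : ℝ)| := by rw [Nat.cast_natAbs, Int.cast_abs]
      rw [h4]
      push_cast
      rcases abs_choice (k : ℝ) with h5 | h5 <;> rw [h5, neg_mul, AddCircle.coe_neg, norm_neg]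
    rw [h2] at h1
    have h3 : ((k.natAbs : ℕ) : ℝ) ^ 2 = (k : ℝ) ^ 2 := by
      rw [Nat.cast_natAbs, Int.cast_abs, sq_abs]
    simp only [hf, ht]
    rw [fourierCoeff_sawtoothSum, norm_mul, mul_pow, h3]
    have h6 : ‖(-1 / (2 * Real.pi * Complex.I * k) : ℂ)‖ ^ 2 = 1 / (4 * Real.pi ^ 2 * k ^ 2) := by
      simp only [norm_div, norm_neg, norm_one, norm_mul, Complex.norm_ofNat, Complex.norm_real,
        Complex.norm_I, Complex.norm_intCast, Real.norm_of_nonneg Real.pi_pos.le]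
      rw [div_pow, mul_pow, mul_pow, mul_pow, sq_abs]
      norm_num
    rw [h6]
    have hpi : (1 : ℝ) / (4 * Real.pi ^ 2 * k ^ 2) ≤ 1 / 4 * (1 / (k : ℝ) ^ 2) := by
      rw [← one_div_mul_one_div, ← one_div_mul_one_div]
      gcongr
      have : 1 / Real.pi ^ 2 ≤ 1 := by
        rw [div_le_one (by positivity)]
        nlinarith [Real.pi_gt_three]
      linarith
    calc _ ≤ _ := mul_le_mul h1 hpi (by positivity) (by positivity)
      _ = _ := by ring
  have hf0 : f 0 = 0 := by
    simp only [hf]; rw [fourierCoeff_sawtoothSum]; simp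
  have hsum := (hasSum_sawtoothSum α N).nat_add_neg_add_one
  refine le_of_tendsto' hsum.tendsto_sum_nat fun L => ?_
  change ∑ n ∈ Finset.range L, (f n + f (-(n + 1))) ≤ A
  have ht0 : ∀ k, 0 ≤ t k := fun k => by positivity
  have h1 : ∀ n : ℕ, f n ≤ 1 / 2 * t n := fun n => by
    rcases eq_or_ne n 0 with rfl | hn
    · simp only [Nat.cast_zero, hf0]; linarith [ht0 0]
    · exact hfk n (by exact_mod_cast hn)
  have h2 : ∀ n : ℕ, f (-(n + 1)) ≤ 1 / 2 * t (n + 1) := fun n => by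
    have := hfk (-(n + 1)) (by omega)
    rwa [show (-((n : ℤ) + 1)).natAbs = n + 1 by omega] at this
  have ht00 : t 0 = 0 := by simp [ht]
  have h3 : ∑ n ∈ Finset.range L, t (n + 1) ≤ A := by
    have := h (L + 1)
    rw [Finset.sum_Ico_eq_sum_range] at this
    simpa only [Nat.add_sub_cancel, add_comm 1] using this
  have h4 : ∑ n ∈ Finset.range L, t n ≤ A := by
    have h5 : ∑ n ∈ Finset.range L, t n ≤ ∑ n ∈ Finset.range (L + 1), t n :=
      Finset.sum_le_sum_of_subset_of_nonneg (Finset.range_mono (Nat.le_succ L)) fun k _ _ => ht0 k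
    rw [Finset.sum_range_succ', ht00, add_zero] at h5
    exact h5.trans h3
  calc _ ≤ ∑ n ∈ Finset.range L, (1 / 2 * t n + 1 / 2 * t (n + 1)) :=
        Finset.sum_le_sum fun n _ => add_le_add (h1 n) (h2 n)
    _ ≤ A := by
        rw [Finset.sum_add_distrib, ← Finset.mul_sum, ← Finset.mul_sum]; linarith

/-! ### From the mean square to the values at the points -/

theorem volume_setOf_fract_mem_Ioo {δ : ℝ} (hδ : δ ≤ 1) :
    volume {x : UnitAddCircle | periodizedBernoulli 1 x + 1 / 2 ∈ Set.Ioo 0 δ} =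
      ENNReal.ofReal δ := by
  have hm : MeasurableSet {x : UnitAddCircle | periodizedBernoulli 1 x + 1 / 2 ∈ Set.Ioo 0 δ} :=
    ((measurable_periodizedBernoulli 1).add_const _) measurableSet_Ioo
  rw [AddCircle.add_projection_respects_measure 1 0 hm]
  have : QuotientAddGroup.mk ⁻¹' {x : UnitAddCircle | periodizedBernoulli 1 x + 1 / 2 ∈
      Set.Ioo 0 δ} ∩ Set.Ioc (0 : ℝ) (0 + 1) = Set.Ioo 0 δ := by
    ext t
    have h1 : periodizedBernoulli 1 ((QuotientAddGroup.mk t : UnitAddCircle)) + 1 / 2 =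
        Int.fract t := by
      rw [show (QuotientAddGroup.mk t : UnitAddCircle) = (t : UnitAddCircle) from rfl,
        periodizedBernoulli_one_coe]; ring
    simp only [Set.mem_inter_iff, Set.mem_preimage, Set.mem_ofPred_eq, h1, Set.mem_Ioo, Set.mem_Ioc,
      zero_add]
    constructor
    · rintro ⟨h2, h3⟩
      have h4 : t ≠ 1 := by
        rintro rfl
        simp at h2
      rw [Int.fract_eq_self.mpr ⟨h3.1.le, lt_of_le_of_ne h3.2 h4⟩] at h2
      exact h2
    · intro h2
      rw [Int.fract_eq_self.mpr ⟨h2.1.le, h2.2.trans_le hδ⟩]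
      exact ⟨h2, h2.1, h2.2.le.trans hδ⟩
  rw [this, Real.volume_Ioo, sub_zero]

theorem norm_coe_le_one_sub_fract (t : ℝ) : ‖(t : UnitAddCircle)‖ ≤ 1 - Int.fract t := by
  rw [UnitAddCircle.norm_eq]
  refine (round_le t (⌊t⌋ + 1)).trans (le_of_eq ?_)
  have h1 : t - ((⌊t⌋ + 1 : ℤ) : ℝ) = -(1 - Int.fract t) := by
    push_cast; rw [← Int.self_sub_floor]; ring
  rw [h1, abs_neg, abs_of_nonneg (by linarith [Int.fract_lt_one t])]

section
variable {α c : ℝ}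

theorem div_le_norm_sub_mul
    (h : ∀ k : ℤ, k ≠ 0 → c ≤ |(k : ℝ)| * ‖((k * α : ℝ) : UnitAddCircle)‖) {N m n : ℕ}
    (hm : m ∈ Finset.Icc 1 N) (hn : n ∈ Finset.Icc 1 N) (hmn : m ≠ n) :
    c / N ≤ ‖(((n : ℝ) * α - m * α : ℝ) : UnitAddCircle)‖ := by
  rw [Finset.mem_Icc] at hm hn
  have hN0 : (0 : ℝ) < N := by exact_mod_cast (show 0 < N by omega)
  have h1 := h ((n : ℤ) - m) (by omega)
  have h2 : |(((n : ℤ) - m : ℤ) : ℝ)| ≤ N := by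
    rw [abs_le]; constructor
    · have : -(N : ℤ) ≤ (n : ℤ) - m := by omega
      exact_mod_cast this
    · have : (n : ℤ) - m ≤ N := by omega
      exact_mod_cast this
  rw [div_le_iff₀ hN0]
  push_cast at h1 h2
  rw [sub_mul] at h1
  have := mul_le_mul_of_nonneg_right h2 (norm_nonneg (((n : ℝ) * α - m * α : ℝ) : UnitAddCircle))
  linarith

/-- Just after the point `n α`, and up to the next point, the sawtooth sum has slope `N`. -/
theorem sawtoothSum_coe_add (hc1 : c ≤ 1)
    (h : ∀ k : ℤ, k ≠ 0 → c ≤ |(k : ℝ)| * ‖((k * α : ℝ) : UnitAddCircle)‖) {N n : ℕ}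
    (hn : n ∈ Finset.Icc 1 N) {s : ℝ} (hs0 : 0 ≤ s) (hs : s < c / N) :
    sawtoothSum α N ((n * α : ℝ) + (s : UnitAddCircle)) =
      sawtoothSum α N ((n * α : ℝ) : UnitAddCircle) + N * s := by
  have hN1 : 1 ≤ N := by rw [Finset.mem_Icc] at hn; omega
  have hN0 : (1 : ℝ) ≤ N := by exact_mod_cast hN1
  have hterm : ∀ m ∈ Finset.Icc 1 N,
      periodizedBernoulli 1 ((n * α : ℝ) + (s : UnitAddCircle) - ((m * α : ℝ) : UnitAddCircle)) =
      periodizedBernoulli 1 (((n * α : ℝ) : UnitAddCircle) - ((m * α : ℝ) : UnitAddCircle)) + s := by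
    intro m hm
    rw [← AddCircle.coe_add, ← AddCircle.coe_sub, ← AddCircle.coe_sub, periodizedBernoulli_one_coe,
      periodizedBernoulli_one_coe]
    set u : ℝ := n * α - m * α with hu
    -- No sawtooth jumps here: a jump would need another point within `c / N`.
    have h1 : Int.fract u + s < 1 := by
      rcases eq_or_ne m n with rfl | hmn
      · have : c / N ≤ 1 := by rw [div_le_one (by linarith)]; linarith
        simp only [hu, sub_self, Int.fract_zero]; linarith
      · have := div_le_norm_sub_mul h hm hn hmn
        have h2 := norm_coe_le_one_sub_fract u
        linarith
    have h2 : Int.fract (u + s) = Int.fract u + s := by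
      rw [Int.fract_eq_iff]
      refine ⟨add_nonneg (Int.fract_nonneg _) hs0, h1, ⌊u⌋, ?_⟩
      rw [← Int.self_sub_floor]; ring
    rw [show (n : ℝ) * α + s - m * α = u + s by rw [hu]; ring, h2]
    ring
  rw [sawtoothSum, Finset.sum_congr rfl hterm, Finset.sum_add_distrib]
  simp [sawtoothSum]

/-- The arcs of length `c / N` following the points are disjoint, and on each of them `S = S(nα) + N
s` with `0 < N s < c`. Hence `S² ≥ S(nα)² / 2 - c²` there, and integration gives the bound. -/
theorem sum_sawtoothSum_sq_le (hc : 0 < c) (hc1 : c ≤ 1)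
    (h : ∀ k : ℤ, k ≠ 0 → c ≤ |(k : ℝ)| * ‖((k * α : ℝ) : UnitAddCircle)‖) {N : ℕ} (hN : 1 ≤ N) :
    ∑ n ∈ Finset.Icc 1 N, sawtoothSum α N ((n * α : ℝ) : UnitAddCircle) ^ 2 ≤
      2 * N / c * (∫ x : UnitAddCircle, sawtoothSum α N x ^ 2) + 2 * N * c ^ 2 := by
  have hN0 : (1 : ℝ) ≤ N := by exact_mod_cast hN
  set p : UnitAddCircle → ℝ := fun x => periodizedBernoulli 1 x + 1 / 2 with hp
  set G : ℕ → ℝ := fun n => sawtoothSum α N ((n * α : ℝ) : UnitAddCircle) with hG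
  set E : ℕ → Set UnitAddCircle := fun n =>
    (fun x => x - ((n * α : ℝ) : UnitAddCircle)) ⁻¹' (p ⁻¹' Set.Ioo 0 (c / N)) with hE
  have hpx : ∀ x, ((p x : ℝ) : UnitAddCircle) = x := by
    intro x
    obtain ⟨t, rfl⟩ := QuotientAddGroup.mk_surjective x
    have h1 : p (t : UnitAddCircle) = Int.fract t := by
      simp only [hp]; rw [periodizedBernoulli_one_coe]; ring
    change ((p (t : UnitAddCircle) : ℝ) : UnitAddCircle) = (t : UnitAddCircle)
    rw [h1, eq_comm, ← sub_eq_zero, ← AddCircle.coe_sub, Int.self_sub_fract]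
    exact AddCircle.coe_eq_zero_iff _ |>.mpr ⟨⌊t⌋, by simp⟩
  have hpm : MeasurableSet (p ⁻¹' Set.Ioo 0 (c / N)) :=
    ((measurable_periodizedBernoulli 1).add_const _) measurableSet_Ioo
  have hEm : ∀ n, MeasurableSet (E n) := fun n => (measurable_id.sub_const _) hpm
  have hEvol : ∀ n, volume.real (E n) = c / N := by
    intro n
    rw [Measure.real, hE]
    rw [(measurePreserving_sub_right volume _).measure_preimage hpm.nullMeasurableSet]
    have h1 := volume_setOf_fract_mem_Ioo (δ := c / N)
      (by rw [div_le_one (by linarith)]; linarith)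
    have h2 : p ⁻¹' Set.Ioo 0 (c / N) =
      {x : UnitAddCircle | periodizedBernoulli 1 x + 1 / 2 ∈ Set.Ioo 0 (c / N)} := rfl
    rw [h2, h1, ENNReal.toReal_ofReal (by positivity)]
  have hdisj : ∀ m ∈ Finset.Icc 1 N, ∀ n ∈ Finset.Icc 1 N, m ≠ n → ∀ x, x ∈ E m → x ∉ E n := by
    intro m hm n hn hmn x hxm hxn
    simp only [hE, Set.mem_preimage, Set.mem_Ioo] at hxm hxn
    have h1 := div_le_norm_sub_mul h hm hn hmn
    have h2 : (((n : ℝ) * α - m * α : ℝ) : UnitAddCircle) =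
        ((p (x - ((m * α : ℝ) : UnitAddCircle)) - p (x - ((n * α : ℝ) : UnitAddCircle)) : ℝ) :
          UnitAddCircle) := by
      rw [AddCircle.coe_sub, AddCircle.coe_sub, hpx, hpx]; abel
    rw [h2, UnitAddCircle.norm_eq] at h1
    have h3 := h1.trans (round_le _ 0)
    rw [Int.cast_zero, sub_zero] at h3
    refine absurd h3 (not_le.mpr ?_)
    rw [abs_lt]; constructor <;> linarith
  have hpt : ∀ x, ∑ n ∈ Finset.Icc 1 N, (E n).indicator (fun _ => G n ^ 2 / 2 - c ^ 2) x ≤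
      sawtoothSum α N x ^ 2 := by
    intro x
    by_cases hx : ∃ n ∈ Finset.Icc 1 N, x ∈ E n
    · obtain ⟨n, hn, hxn⟩ := hx
      rw [Finset.sum_eq_single_of_mem n hn fun m hm hmn =>
        Set.indicator_of_notMem (hdisj n hn m hm hmn.symm x hxn) _, Set.indicator_of_mem hxn]
      simp only [hE, Set.mem_preimage, Set.mem_Ioo] at hxn
      set s := p (x - ((n * α : ℝ) : UnitAddCircle)) with hs
      have h1 := sawtoothSum_coe_add hc1 h hn hxn.1.le hxn.2
      rw [hs, hpx, add_sub_cancel, ← hs] at h1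
      rw [h1]
      have h2 : (N : ℝ) * s ≤ c := by
        have := (lt_div_iff₀ (by linarith)).mp hxn.2
        linarith
      have h3 : 0 ≤ (N : ℝ) * s := mul_nonneg (by linarith) hxn.1.le
      have h4 : ((N : ℝ) * s) ^ 2 ≤ c ^ 2 := by gcongr
      nlinarith [sq_nonneg (G n + 2 * (N * s))]
    · push Not at hx
      rw [Finset.sum_eq_zero fun n hn => Set.indicator_of_notMem (hx n hn) _]
      positivity
  have hint : ∀ n ∈ Finset.Icc 1 N, Integrable
      ((E n).indicator (fun _ => G n ^ 2 / 2 - c ^ 2)) (volume : Measure UnitAddCircle) :=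
    fun n _ => (integrable_const _).indicator (hEm n)
  have hle := integral_mono (integrable_finsetSum _ hint) (integrable_sawtoothSum_sq α N) hpt
  rw [integral_finsetSum _ hint] at hle
  simp only [integral_indicator_const _ (hEm _), hEvol, smul_eq_mul] at hle
  rw [← Finset.mul_sum, Finset.sum_sub_distrib, ← Finset.sum_div] at hle
  simp only [Finset.sum_const, Nat.card_Icc, Nat.add_sub_cancel, nsmul_eq_mul] at hle
  have h5 := mul_le_mul_of_nonneg_left hle (show 0 ≤ 2 * N / c by positivity)
  have h6 : 2 * N / c * (c / N * ((∑ n ∈ Finset.Icc 1 N, G n ^ 2) / 2 - N * c ^ 2)) =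
      (∑ n ∈ Finset.Icc 1 N, G n ^ 2) - 2 * N * c ^ 2 := by
    field_simp
  linarith

/-! ### Ranks and the sawtooth -/

/-- The rank of the `n`-th point among the first `N` points of the Kronecker sequence. -/
noncomputable def kroneckerRank (α : ℝ) (N n : ℕ) : ℕ :=
  ((Finset.Icc 1 N).filter fun m : ℕ => Int.fract (m * α) ≤ Int.fract (n * α)).card

theorem bijOn_kroneckerRank (hc : 0 < c)
    (h : ∀ k : ℤ, k ≠ 0 → c ≤ |(k : ℝ)| * ‖((k * α : ℝ) : UnitAddCircle)‖) (N : ℕ) :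
    Set.BijOn (kroneckerRank α N) (Finset.Icc 1 N) (Finset.Icc 1 N) := by
  have hmaps : Set.MapsTo (kroneckerRank α N) (Finset.Icc 1 N) (Finset.Icc 1 N) := by
    intro n hn
    rw [Finset.mem_coe] at hn ⊢
    rw [Finset.mem_Icc]
    constructor
    · exact Finset.card_pos.mpr ⟨n, Finset.mem_filter.mpr ⟨hn, le_rfl⟩⟩
    · exact (Finset.card_filter_le _ _).trans (by simp)
  have hlt : ∀ n ∈ Finset.Icc 1 N, ∀ n' ∈ Finset.Icc 1 N,
      Int.fract (n * α) < Int.fract (n' * α) → kroneckerRank α N n < kroneckerRank α N n' := by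
    intro n hn n' hn' hlt
    refine Finset.card_lt_card ⟨fun m hm => ?_, fun hsub => ?_⟩
    · rw [Finset.mem_filter] at hm ⊢
      exact ⟨hm.1, hm.2.trans hlt.le⟩
    · have := hsub (Finset.mem_filter.mpr ⟨hn', le_rfl⟩)
      rw [Finset.mem_filter] at this
      exact absurd hlt (not_lt.mpr this.2)
  have hinj : Set.InjOn (kroneckerRank α N) (Finset.Icc 1 N) := by
    intro m hm n hn hmn
    rw [Finset.mem_coe] at hm hn
    by_contra hne
    rcases lt_trichotomy (Int.fract (m * α)) (Int.fract (n * α)) with h1 | h1 | h1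
    · exact absurd hmn (hlt m hm n hn h1).ne
    · obtain ⟨z, hz⟩ := Int.fract_eq_fract.mp h1.symm
      have h2 := div_le_norm_sub_mul h hm hn hne
      rw [hz, UnitAddCircle.norm_eq, round_intCast, sub_self, abs_zero] at h2
      have hN0 : (0 : ℝ) < N := by
        rw [Finset.mem_Icc] at hm
        exact_mod_cast (show 0 < N by omega)
      exact absurd h2 (not_le.mpr (by positivity))
    · exact absurd hmn (hlt n hn m hm h1).ne'
  refine ⟨hmaps, hinj, ?_⟩
  exact Finset.surjOn_of_injOn_of_card_le _ hmaps hinj le_rfl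

/-- For `x, y` in `[0, 1)`, `{x - y}` is `x - y` or `x - y + 1` according to whether `y ≤ x`, so the
sawtooth records the order. The term `m = n` counts, matching the value `-1 / 2` of the sawtooth at
`0`. -/
theorem kroneckerRank_eq (α : ℝ) (N n : ℕ) :
    (kroneckerRank α N n : ℝ) = N * Int.fract (n * α) +
      ∑ m ∈ Finset.Icc 1 N, (1 / 2 - Int.fract (m * α)) -
      sawtoothSum α N ((n * α : ℝ) : UnitAddCircle) := by
  have hterm : ∀ m ∈ Finset.Icc 1 N,
      (if Int.fract ((m : ℝ) * α) ≤ Int.fract (n * α) then (1 : ℝ) else 0) =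
      Int.fract (n * α) + (1 / 2 - Int.fract (m * α)) - periodizedBernoulli 1
        (((n * α : ℝ) : UnitAddCircle) - ((m * α : ℝ) : UnitAddCircle)) := by
    intro m _
    rw [← AddCircle.coe_sub, periodizedBernoulli_one_coe]
    have h1 := Int.fract_nonneg ((m : ℝ) * α)
    have h2 := Int.fract_lt_one ((m : ℝ) * α)
    have h3 := Int.fract_nonneg ((n : ℝ) * α)
    have h4 := Int.fract_lt_one ((n : ℝ) * α)
    split_ifs with hle
    · have : Int.fract ((n : ℝ) * α - m * α) = Int.fract ((n : ℝ) * α) - Int.fract (m * α) := by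
        rw [Int.fract_eq_iff]
        refine ⟨by linarith, by linarith, ⌊(n : ℝ) * α⌋ - ⌊(m : ℝ) * α⌋, ?_⟩
        push_cast
        rw [← Int.self_sub_floor, ← Int.self_sub_floor]; ring
      rw [this]; ring
    · have : Int.fract ((n : ℝ) * α - m * α) =
          Int.fract ((n : ℝ) * α) - Int.fract (m * α) + 1 := by
        rw [Int.fract_eq_iff]
        refine ⟨by linarith, by linarith, ⌊(n : ℝ) * α⌋ - ⌊(m : ℝ) * α⌋ - 1, ?_⟩
        push_cast
        rw [← Int.self_sub_floor, ← Int.self_sub_floor]; ring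
      rw [this]; ring
  rw [kroneckerRank, Finset.card_filter]
  push_cast
  rw [Finset.sum_congr rfl hterm, Finset.sum_sub_distrib, Finset.sum_add_distrib]
  simp [sawtoothSum]

theorem wassersteinDist_kroneckerMeasure_le (hc : 0 < c)
    (h : ∀ k : ℤ, k ≠ 0 → c ≤ |(k : ℝ)| * ‖((k * α : ℝ) : UnitAddCircle)‖) {N : ℕ} (hN : 1 ≤ N) :
    wassersteinDist 2 (kroneckerMeasure α N) (volume : Measure UnitAddCircle) ≤
      ENNReal.ofReal (Real.sqrt (2 / (N : ℝ) ^ 3 *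
        ∑ n ∈ Finset.Icc 1 N, sawtoothSum α N ((n * α : ℝ) : UnitAddCircle) ^ 2 +
          2 / (N : ℝ) ^ 2)) := by
  have hN0 : (0 : ℝ) < N := by exact_mod_cast hN
  -- This shift cancels the part of the rank that does not depend on `n`.
  refine (wassersteinDist_two_sq_le hN (fun n => Int.fract ((n : ℝ) * α))
    (-(∑ m ∈ Finset.Icc 1 N, (1 / 2 - Int.fract (m * α))) / N)
    (bijOn_kroneckerRank hc h N)).trans (le_of_eq ?_)
  congr 3
  rw [Finset.mul_sum, Finset.mul_sum]
  refine Finset.sum_congr rfl fun n _ => ?_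
  rw [kroneckerRank_eq]
  field_simp
  ring
end

/-! ### Conclusion -/

theorem theorem3 (α : ℝ) (hα : BadlyApproximable α) :
    ∃ C : ℝ, 0 < C ∧ ∀ N : ℕ, 2 ≤ N →
      wassersteinDist 2 (kroneckerMeasure α N) (volume : Measure UnitAddCircle) ≤
        ENNReal.ofReal (C * (Real.sqrt (Real.log (N : ℝ)) / (N : ℝ))) := by
  obtain ⟨c, hc, h⟩ := hα.exists_le_mul_norm
  obtain ⟨A, hA, hsum⟩ := exists_sum_div_sq_le hc h
  have hc1 : c ≤ 1 := by
    have h1 := h 1 one_ne_zero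
    rw [UnitAddCircle.norm_eq] at h1
    have h2 := abs_sub_round (((1 : ℤ) : ℝ) * α)
    norm_num at h1 h2
    linarith
  set K : ℝ := 16 * A / c + 12 with hK
  have hlog2 : (1 / 2 : ℝ) < Real.log 2 := by linarith [Real.log_two_gt_d9]
  refine ⟨Real.sqrt (2 * K), by positivity, fun N hN => ?_⟩
  have hN0 : (0 : ℝ) < N := by exact_mod_cast (show 0 < N by omega)
  have hlogN : 1 / 2 < Real.log N := hlog2.trans_le
    (Real.log_le_log (by norm_num) (by exact_mod_cast hN))
  set J := Nat.clog 2 N with hJ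
  have hJN : N ≤ 2 ^ J := Nat.le_pow_clog one_lt_two N
  -- From `(J - 1) log 2 ≤ log N` and `log 2 > 1 / 2`, `J + 2 ≤ 2 log N + 3`; the `3` is absorbed
  -- since `log N > 1 / 2`.
  have hJlog : (J : ℝ) + 2 ≤ 8 * Real.log N := by
    have h1 : 2 ^ (J - 1) ≤ N := (Nat.pow_pred_clog_lt_self one_lt_two (by omega)).le
    have h2 : ((2 : ℝ)) ^ (J - 1) ≤ N := by exact_mod_cast h1
    have h3 := Real.log_le_log (by positivity) h2
    rw [Real.log_pow] at h3
    have h4 : (J : ℝ) ≤ ((J - 1 : ℕ) : ℝ) + 1 := by exact_mod_cast (show J ≤ J - 1 + 1 by omega)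
    have h5 : 0 ≤ ((J - 1 : ℕ) : ℝ) := Nat.cast_nonneg _
    nlinarith
  have hint : ∫ x : UnitAddCircle, sawtoothSum α N x ^ 2 ≤ A * (J + 2) :=
    integral_sawtoothSum_sq_le fun L => hsum J L N (by omega) hJN
  have hpts := sum_sawtoothSum_sq_le hc hc1 h (show 1 ≤ N by omega)
  refine (wassersteinDist_kroneckerMeasure_le hc h (show 1 ≤ N by omega)).trans
    (ENNReal.ofReal_le_ofReal ?_)
  have hrhs : Real.sqrt (2 * K) * (Real.sqrt (Real.log N) / N) =
      Real.sqrt (2 * K * Real.log N / (N : ℝ) ^ 2) := by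
    rw [Real.sqrt_div' _ (by positivity), Real.sqrt_sq hN0.le, Real.sqrt_mul (show 0 ≤ 2 * K by positivity)]
    ring
  rw [hrhs]
  refine Real.sqrt_le_sqrt ?_
  have hbound : ∑ n ∈ Finset.Icc 1 N, sawtoothSum α N ((n * α : ℝ) : UnitAddCircle) ^ 2 ≤
      N * (16 * A / c * Real.log N + 2) := by
    refine hpts.trans ?_
    have h1 : 2 * N / c * (∫ x : UnitAddCircle, sawtoothSum α N x ^ 2) ≤
        2 * N / c * (A * (8 * Real.log N)) := by
      gcongr
      exact hint.trans (by gcongr)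
    have h2 : 2 * (N : ℝ) * c ^ 2 ≤ 2 * N := by
      have : c ^ 2 ≤ 1 := by nlinarith
      nlinarith
    have h3 : 2 * N / c * (A * (8 * Real.log N)) = N * (16 * A / c * Real.log N) := by ring
    linarith
  calc _ ≤ 2 / (N : ℝ) ^ 3 * (N * (16 * A / c * Real.log N + 2)) + 2 / (N : ℝ) ^ 2 := by gcongr
    _ = (2 * (16 * A / c * Real.log N) + 6) / (N : ℝ) ^ 2 := by field_simp; ring
    _ ≤ _ := by
        gcongr
        rw [hK]
        linarith
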